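/- All graphs are finite and simple. For a graph $G$ with real adjacency matrix $A(G)$, let $\mathcal N(G)=\{x\in\mathbb R^{V(G)} : A(G)x=0\}$ be its null space, $\operatorname{null}(G)=\dim\mathcal N(G)$, $\operatorname{rank}(G)=\operatorname{rank}A(G)$, let $\operatorname{Supp}(G)$ be the set of vertices $v$ with $x_v\neq 0$ for some $x\in\mathcal N(G)$, and let $\operatorname{Core}(G)=N(\operatorname{Supp}(G))$ be the set of neighbours of vertices of $\operatorname{Supp}(G)$. Let $\mathcal M(G)$ be the set of maximum (cardinality) matchings of $G$, a matching being a set of edges no two of which share a vertex. Let $T$ be a tree. The S-parts of $T$ are the connected components of the subgraph of $T$ induced by the closed neighbourhood $N[\operatorname{Supp}(T)]$; the N-parts are the connected components of the subgraph induced by the remaining vertices. A connection edge of $T$ is an edge of $T$ that belongs to no S-part and to no N-part; $\operatorname{ConnE}(T)$ is the set of connection edges. Let $e\in\operatorname{ConnE}(T)$. Then $e$ has an endpoint in exactly one S-part, $S_e$, and in exactly one N-part, $N_e$. For every $u\in\operatorname{Core}(S_e)$ and every $v\in V(N_e)$, the graph $T(e,u,v)=T-e+\{u,v\}$, obtained from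 $T$ by replacing the edge $e$ by $\{u,v\}$, is a tree, and: 1. if $M\in\mathcal M(T)$ and $M\cap\operatorname{ConnE}(T)=\emptyset$, then $M\in\mathcal M(T(e,u,v))$; 2. $\mathcal N(T)=\mathcal N(T(e,u,v))$; 3. $\operatorname{null}(T)=\operatorname{null}(T(e,u,v))$; 4. $\operatorname{rank}(T)=\operatorname{rank}(T(e,u,v))$. -/

import Mathlib

namespace NullDecomp

noncomputable section

variable {V : Type*}

open Classical in
/-- The real adjacency matrix of a finite simple graph. -/
def adjMat (G : SimpleGraph V) : Matrix V V ℝ := G.adjMatrix ℝ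

/-- The null space of `G`: the vectors `x` with `A(G) x = 0`. -/
def nullSpace [Fintype V] (G : SimpleGraph V) : Submodule ℝ (V → ℝ) :=
  LinearMap.ker (adjMat G).mulVecLin

/-- The nullity of `G`. -/
def nullity [Fintype V] (G : SimpleGraph V) : ℕ := Module.finrank ℝ (nullSpace G)

/-- The rank of `G`. -/
def rank [Fintype V] (G : SimpleGraph V) : ℕ := (adjMat G).rank

/-- `Supp(G)`: the vertices at which some vector of the null space is non-zero. -/
def supp [Fintype V] (G : SimpleGraph V) : Set V := {v | ∃ x ∈ nullSpace G, x v ≠ 0}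

/-- The open neighbourhood `N(W)` of a set of vertices. -/
def nbhd (G : SimpleGraph V) (W : Set V) : Set V := ⋃ w ∈ W, G.neighborSet w

/-- The closed neighbourhood `N[W] = W ∪ N(W)`. -/
def closedNbhd (G : SimpleGraph V) (W : Set V) : Set V := W ∪ nbhd G W

/-- `Core(G) = N(Supp(G))`. -/
def core [Fintype V] (G : SimpleGraph V) : Set V := nbhd G (supp G)

/-- The vertex sets, in `V`, of the connected components of the subgraph of `G` induced by `W`.
Such a component is the subgraph of `G` induced by its vertex set. -/
def components (G : SimpleGraph V) (W : Set V) : Set (Set V) :=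
  {P | ∃ C : (G.induce W).ConnectedComponent, P = Subtype.val '' C.supp}

/-- The S-set of `T`, each part being given by its vertex set: the components of the
subgraph induced by `N[Supp(T)]`. -/
def sParts [Fintype V] (T : SimpleGraph V) : Set (Set V) :=
  components T (closedNbhd T (supp T))

/-- The N-set of `T`, each part being given by its vertex set: the components of what is left of
`T` when the vertices of the S-parts are removed. -/
def nParts [Fintype V] (T : SimpleGraph V) : Set (Set V) :=
  components T (⋃₀ sParts T)ᶜ

/-- The edges of `G` that are edges of one of the induced subgraphs on the sets in `F`. -/
def partEdges (G : SimpleGraph V) (F : Set (Set V)) : Set (Sym2 V) :=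
  {e | e ∈ G.edgeSet ∧ ∃ P ∈ F, ∀ x ∈ e, x ∈ P}

/-- The connection edges of `T`: the edges that belong neither to an S-part nor to an N-part. -/
def connEdges [Fintype V] (T : SimpleGraph V) : Set (Sym2 V) :=
  T.edgeSet \ (partEdges T (sParts T) ∪ partEdges T (nParts T))

open Classical in
/-- The core, as a set of vertices of `T`, of the induced subgraph on `S`; the support and the
neighbourhoods are those of the induced subgraph itself. -/
def partCore [Fintype V] (T : SimpleGraph V) (S : Set V) : Set V :=
  Subtype.val '' core (T.induce S)

/-- `e` has an endpoint in `P`. -/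
def Meets (e : Sym2 V) (P : Set V) : Prop := ∃ x ∈ e, x ∈ P

/-- `T(e,u,v) = T - e + {u,v}`. -/
def replaceEdge (T : SimpleGraph V) (e : Sym2 V) (u v : V) : SimpleGraph V :=
  T.deleteEdges {e} ⊔ SimpleGraph.edge u v

/-- `M` is a matching of `G`: a set of edges no two of which share a vertex. -/
def IsMatching (G : SimpleGraph V) (M : Finset (Sym2 V)) : Prop :=
  (∀ e ∈ M, e ∈ G.edgeSet) ∧
    ∀ e ∈ M, ∀ f ∈ M, e ≠ f → ∀ x : V, ¬ (x ∈ e ∧ x ∈ f)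

/-- The set of all maximum matchings of `G`. -/
def maxMatchings (G : SimpleGraph V) : Set (Finset (Sym2 V)) :=
  {M | IsMatching G M ∧ ∀ M', IsMatching G M' → M'.card ≤ M.card}

end

end NullDecomp

/-! Write `e = s(a, b)` with `a` in an S-part and `b` in an N-part, and let G be T - e. Everything
rests on comparing null spaces across a bridge. Since A(G) is symmetric, its image is the orthogonal
complement of the null space, so a vertex avoids the support exactly when its unit vector lies in
the image. If two components of a forest are joined by an edge whose ends avoid the support, such
preimages, chosen to vanish at both ends, show that no null vector is created
(`nullSpace_sup_edge`). This applies twice over G. Neither `a` nor `b` lies in Supp(T), but `a` has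
a neighbour in Supp(T), which stays in Supp(G). The support of a forest is independent
(`not_mem_supp_of_adj`), so `a` avoids Supp(G), and then so does `b` (`not_mem_supp_of_sup_edge`).
Hence G and T have the same null space and support. The vertices `u` and `v` avoid that support and
lie on the two sides of the bridge, so adding `s(u, v)` changes nothing either. Rank and nullity
follow. As the rank of a forest is twice its matching number (`rank_eq_two_mul_matching`), a maximum
matching of T that avoids `e` stays maximum. -/

namespace NullDecomp

/-! ### Adjacency matrices, supports and 2-colourings -/

open Classical in
/-- The action of the adjacency matrix on vectors, as a sum over neighbours. -/
theorem adjMat_mulVec_apply {V : Type*} [Fintype V] (G : SimpleGraph V) (x : V → ℝ) (v : V) :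
    (adjMat G).mulVec x v = ∑ w, if G.Adj v w then x w else 0 := by
  simp [adjMat, Matrix.mulVec, dotProduct, SimpleGraph.adjMatrix_apply]

theorem mem_nullSpace_iff {V : Type*} [Fintype V] (G : SimpleGraph V) (x : V → ℝ) :
    x ∈ nullSpace G ↔ (adjMat G).mulVec x = 0 := by
  simp [nullSpace]

theorem not_mem_supp_iff {V : Type*} [Fintype V] {G : SimpleGraph V} {v : V} :
    v ∉ supp G ↔ ∀ x ∈ nullSpace G, x v = 0 := by
  simp [supp]

theorem dotProduct_adjMat_mulVec {V : Type*} [Fintype V] (G : SimpleGraph V) (x y : V → ℝ) :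
    x ⬝ᵥ (adjMat G).mulVec y = (adjMat G).mulVec x ⬝ᵥ y := by
  rw [Matrix.dotProduct_mulVec, ← Matrix.mulVec_transpose]
  simp [adjMat]

open Classical in
theorem adjMat_mulVec_sup_edge {V : Type*} [Fintype V] {G : SimpleGraph V} {a b : V}
    (hab : a ≠ b) (hG : ¬ G.Adj a b) (x : V → ℝ) :
    (adjMat (G ⊔ SimpleGraph.edge a b)).mulVec x =
      (adjMat G).mulVec x + x b • Pi.single a 1 + x a • Pi.single b 1 := by
  have hG' : ¬ G.Adj b a := fun h => hG h.symm
  ext v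
  have h1 : x b • (Pi.single a 1 : V → ℝ) v = ∑ w, if v = a ∧ w = b then x w else 0 := by
    by_cases h : v = a <;> simp [h]
  have h2 : x a • (Pi.single b 1 : V → ℝ) v = ∑ w, if v = b ∧ w = a then x w else 0 := by
    by_cases h : v = b <;> simp [h]
  rw [Pi.add_apply, Pi.add_apply, Pi.smul_apply, Pi.smul_apply, h1, h2, adjMat_mulVec_apply,
    adjMat_mulVec_apply, ← Finset.sum_add_distrib, ← Finset.sum_add_distrib]
  refine Finset.sum_congr rfl fun w _ => ?_
  simp only [SimpleGraph.sup_adj, SimpleGraph.edge_adj]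
  by_cases h3 : v = a ∧ w = b
  · obtain ⟨rfl, rfl⟩ := h3
    simp [hG, hab]
  · by_cases h4 : v = b ∧ w = a
    · obtain ⟨rfl, rfl⟩ := h4
      simp [hG', hab]
      intro h; exact absurd h.symm hab
    · simp [h3, h4]

/-- Restricting a vector to a colour class restricts its image to the other class. -/
theorem adjMat_mulVec_restrict {V : Type*} [Fintype V] {G : SimpleGraph V} {c : V → Bool}
    (hc : ∀ v w, G.Adj v w → c v ≠ c w) (k : Bool) (x : V → ℝ) (v : V) :
    (adjMat G).mulVec (fun w => if c w = k then x w else 0) v =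
      if c v = k then 0 else (adjMat G).mulVec x v := by
  classical
  rw [adjMat_mulVec_apply, adjMat_mulVec_apply]
  split_ifs with h
  · refine Finset.sum_eq_zero fun w _ => ?_
    split_ifs with h1 h2
    · exact absurd (h.trans h2.symm) (hc v w h1)
    all_goals rfl
  · refine Finset.sum_congr rfl fun w _ => ?_
    split_ifs with h1 h2
    · rfl
    · have := hc v w h1
      cases h3 : c v <;> cases h4 : c w <;> cases k <;> simp_all
    · rfl

theorem restrict_mem_nullSpace {V : Type*} [Fintype V] {G : SimpleGraph V} {c : V → Bool}
    (hc : ∀ v w, G.Adj v w → c v ≠ c w) (k : Bool) {x : V → ℝ} (hx : x ∈ nullSpace G) :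
    (fun w => if c w = k then x w else 0) ∈ nullSpace G := by
  rw [mem_nullSpace_iff] at hx ⊢
  ext v
  rw [adjMat_mulVec_restrict hc, hx]
  simp

/-- Outside the support, unit vectors lie in the image of the adjacency matrix. -/
theorem exists_adjMat_mulVec_eq_single {V : Type*} [Fintype V] [DecidableEq V]
    {G : SimpleGraph V} {v : V} (hv : v ∉ supp G) :
    ∃ q : V → ℝ, (adjMat G).mulVec q = Pi.single v 1 := by
  have h : (LinearMap.proj v : (V → ℝ) →ₗ[ℝ] ℝ) ∈
      LinearMap.range (adjMat G).mulVecLin.dualMap := by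
    -- Evaluation at `v` kills the null space, so it factors through the matrix; symmetry turns the
    -- factor into a preimage.
    rw [LinearMap.range_dualMap_eq_dualAnnihilator_ker, Submodule.mem_dualAnnihilator]
    exact fun x hx => not_mem_supp_iff.1 hv x hx
  obtain ⟨φ, hφ⟩ := h
  refine ⟨fun w => φ (Pi.single w 1), ?_⟩
  have hφ' : ∀ x, φ x = (fun w => φ (Pi.single w 1)) ⬝ᵥ x := by
    intro x
    conv_lhs => rw [pi_eq_sum_univ' x]
    simp [dotProduct, mul_comm, map_sum, Pi.single]
  ext w
  have h1 := LinearMap.congr_fun hφ (Pi.single w 1)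
  rw [LinearMap.dualMap_apply, Matrix.mulVecLin_apply, hφ', dotProduct_adjMat_mulVec] at h1
  simpa [Pi.single_apply, eq_comm] using h1

/-- For a proper 2-colouring, the preimage of a unit vector can be taken on the opposite class. -/
theorem exists_preimage_single_of_coloring {V : Type*} [Fintype V] [DecidableEq V]
    {G : SimpleGraph V} {c : V → Bool} (hc : ∀ v w, G.Adj v w → c v ≠ c w) {v : V}
    (hv : v ∉ supp G) :
    ∃ q : V → ℝ, (adjMat G).mulVec q = Pi.single v 1 ∧ ∀ w, c w = c v → q w = 0 := by
  obtain ⟨q, hq⟩ := exists_adjMat_mulVec_eq_single hv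
  refine ⟨fun w => if c w = !c v then q w else 0, ?_, fun w hw => by simp [hw]⟩
  ext w
  rw [adjMat_mulVec_restrict hc, hq]
  by_cases h : w = v
  · subst h; simp
  · simp [h]

theorem exists_coloring {V : Type*} {G : SimpleGraph V} (hG : G.IsAcyclic) :
    ∃ c : V → Bool, ∀ v w, G.Adj v w → c v ≠ c w := by
  obtain ⟨c⟩ := hG.colorable_two
  refine ⟨fun v => decide (c v = 0), fun v w h => ?_⟩
  have h1 := c.valid h
  simp only [ne_eq, decide_eq_decide]
  generalize c v = i at h1 ⊢
  generalize c w = j at h1 ⊢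
  revert i j
  decide

/-- Swapping the two colours on the component of `a` keeps a colouring proper and leaves `b`
untouched. -/
theorem exists_coloring_eq {V : Type*} {G : SimpleGraph V} (hG : G.IsAcyclic) {a b : V}
    (hab : ¬ G.Reachable a b) :
    ∃ c : V → Bool, (∀ v w, G.Adj v w → c v ≠ c w) ∧ c a = c b := by
  classical
  obtain ⟨c, hc⟩ := exists_coloring hG
  by_cases h : c a = c b
  · exact ⟨c, hc, h⟩
  refine ⟨fun v => if G.Reachable a v then !c v else c v, fun v w hvw => ?_, ?_⟩
  · have h1 : G.Reachable a v ↔ G.Reachable a w :=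
      ⟨fun h => h.trans hvw.reachable, fun h => h.trans hvw.symm.reachable⟩
    have := hc v w hvw
    simp only [h1]
    split_ifs <;> simp_all
  · simp [hab]
    cases h1 : c a <;> cases h2 : c b <;> simp_all

/-! ### Null spaces and supports across a bridge -/

/-- Joining two components of a forest at vertices outside the support keeps the null space. -/
theorem nullSpace_sup_edge {V : Type*} [Fintype V] {G : SimpleGraph V} (hG : G.IsAcyclic)
    {a b : V} (hab : ¬ G.Reachable a b) (ha : a ∉ supp G) (hb : b ∉ supp G) :
    nullSpace (G ⊔ SimpleGraph.edge a b) = nullSpace G := by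
  classical
  have hne : a ≠ b := by rintro rfl; exact hab (SimpleGraph.Reachable.refl _)
  have hadj : ¬ G.Adj a b := fun h => hab h.reachable
  obtain ⟨c, hc, hcab⟩ := exists_coloring_eq hG hab
  obtain ⟨q, hq, hq0⟩ := exists_preimage_single_of_coloring hc ha
  obtain ⟨r, hr, hr0⟩ := exists_preimage_single_of_coloring hc hb
  ext x
  constructor
  · intro hx
    have hx' := (mem_nullSpace_iff _ _).1 hx
    rw [adjMat_mulVec_sup_edge hne hadj] at hx'
    -- The corrections `q` and `r` live on the colour opposite to that of `a` and `b`, so this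
    -- vector agrees with `x` at both ends, forcing `x a = x b = 0`.
    have hy : x + x b • q + x a • r ∈ nullSpace G := by
      rw [mem_nullSpace_iff, Matrix.mulVec_add, Matrix.mulVec_add, Matrix.mulVec_smul,
        Matrix.mulVec_smul, hq, hr, hx']
    have hxa := not_mem_supp_iff.1 ha _ hy
    have hxb := not_mem_supp_iff.1 hb _ hy
    simp [hq0 a rfl, hr0 a hcab] at hxa
    simp [hq0 b hcab.symm, hr0 b rfl] at hxb
    rw [mem_nullSpace_iff]
    simpa [hxa, hxb] using hx'
  · intro hx
    rw [mem_nullSpace_iff, adjMat_mulVec_sup_edge hne hadj, (mem_nullSpace_iff _ _).1 hx,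
      not_mem_supp_iff.1 ha _ hx, not_mem_supp_iff.1 hb _ hx]
    simp

theorem deleteEdges_sup_edge_eq {V : Type*} {T : SimpleGraph V} {a b : V} (h : T.Adj a b) :
    T.deleteEdges {s(a, b)} ⊔ SimpleGraph.edge a b = T := by
  ext v w
  have hne := h.ne
  simp only [SimpleGraph.sup_adj, SimpleGraph.deleteEdges_adj, SimpleGraph.edge_adj,
    Set.mem_singleton_iff, Sym2.eq_iff]
  constructor
  · rintro (h1 | ⟨⟨rfl, rfl⟩ | ⟨rfl, rfl⟩, -⟩)
    · exact h1.1
    · exact h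
    · exact h.symm
  · intro h1
    have := h1.ne
    tauto

theorem not_reachable_deleteEdges {V : Type*} {T : SimpleGraph V} (hT : T.IsAcyclic) {a b : V}
    (h : T.Adj a b) : ¬ (T.deleteEdges {s(a, b)}).Reachable a b :=
  SimpleGraph.isBridge_iff.1 (SimpleGraph.isAcyclic_iff_forall_adj_isBridge.1 hT h)

/-- The support of a forest is an independent set. -/
theorem not_mem_supp_of_adj {V : Type*} [Fintype V] {T : SimpleGraph V} (hT : T.IsAcyclic)
    {a b : V} (h : T.Adj a b) (ha : a ∈ supp T) : b ∉ supp T := by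
  classical
  rintro ⟨z, hz, hzb⟩
  obtain ⟨y, hy, hya⟩ := ha
  obtain ⟨d, hd⟩ := exists_coloring hT
  have hdab := hd a b h
  set G := T.deleteEdges {s(a, b)} with hGdef
  have hGT : G ≤ T := SimpleGraph.deleteEdges_le _
  have hnr : ¬ G.Reachable a b := not_reachable_deleteEdges hT h
  have hadj : ¬ G.Adj a b := fun h => hnr h.reachable
  obtain ⟨c, hc, hcab⟩ := exists_coloring_eq (hT.anti hGT) hnr
  have hTG : T = G ⊔ SimpleGraph.edge a b := (deleteEdges_sup_edge_eq h).symm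
  have key : ∀ x ∈ nullSpace T, (adjMat G).mulVec x = - (x b • Pi.single a 1 + x a • Pi.single b 1) := by
    intro x hx
    rw [mem_nullSpace_iff, hTG, adjMat_mulVec_sup_edge h.ne hadj, add_assoc] at hx
    exact eq_neg_of_add_eq_zero_left hx
  have hy1 := key _ (restrict_mem_nullSpace hd (d a) hy)
  have hz1 := key _ (restrict_mem_nullSpace hd (d b) hz)
  simp only [hdab, hdab.symm, if_true, if_false, zero_smul, zero_add, add_zero] at hy1 hz1
  set y1 : V → ℝ := fun w => if d w = d a then y w else 0 with hy1def
  set z1 : V → ℝ := fun w => if d w = d b then z w else 0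
  -- Off the bridge, `y1` maps to a multiple of the unit vector at `b`. As `a` and `b` share a
  -- colour in `c`, restricting to that colour kills this image but keeps the value at `a`. Pairing
  -- with `z1`, which maps to a multiple of the unit vector at `a`, gives `y a * z b = 0`.
  have hy2 : (adjMat G).mulVec (fun w => if c w = c a then y1 w else 0) = 0 := by
    ext v
    rw [adjMat_mulVec_restrict hc, hy1]
    by_cases hv : v = b
    · simp [hv, hcab]
    · simp [hv]
  have hdot := dotProduct_adjMat_mulVec G (fun w => if c w = c a then y1 w else 0) z1
  rw [hy2, hz1] at hdot
  simp [hy1def] at hdot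
  exact hdot.elim hzb hya

/-- If both ends of a bridge avoid the support of a forest, and one end avoids the support
after its removal, then so does the other end. -/
theorem not_mem_supp_of_sup_edge {V : Type*} [Fintype V] {G : SimpleGraph V} (hG : G.IsAcyclic)
    {a b : V} (hab : ¬ G.Reachable a b) (ha : a ∉ supp G)
    (ha' : a ∉ supp (G ⊔ SimpleGraph.edge a b)) (hb' : b ∉ supp (G ⊔ SimpleGraph.edge a b)) :
    b ∉ supp G := by
  classical
  have hne : a ≠ b := by rintro rfl; exact hab (SimpleGraph.Reachable.refl _)
  have hadj : ¬ G.Adj a b := fun h => hab h.reachable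
  obtain ⟨c, hc, hcab⟩ := exists_coloring_eq hG hab
  obtain ⟨q, hq, hq0⟩ := exists_preimage_single_of_coloring hc ha
  rw [not_mem_supp_iff]
  intro z hz
  have hza := not_mem_supp_iff.1 ha z hz
  have : z - z b • q ∈ nullSpace (G ⊔ SimpleGraph.edge a b) := by
    rw [mem_nullSpace_iff, adjMat_mulVec_sup_edge hne hadj, Matrix.mulVec_sub,
      Matrix.mulVec_smul, hq, (mem_nullSpace_iff _ _).1 hz]
    simp [hq0 a rfl, hq0 b hcab.symm, hza]
  simpa [hq0 b hcab.symm] using not_mem_supp_iff.1 hb' _ this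

/-! ### Rank and maximum matchings of forests -/

/-- A finite forest with an edge has a leaf. -/
theorem exists_leaf {V : Type*} [Finite V] {G : SimpleGraph V} (hG : G.IsAcyclic)
    (hne : G ≠ ⊥) : ∃ p q, G.Adj p q ∧ ∀ w, G.Adj p w → w = q := by
  obtain ⟨a, b, hab⟩ := SimpleGraph.ne_bot_iff_exists_adj.1 hne
  have : Nonempty V := ⟨a⟩
  have ⟨u, v, p, hp, hmax⟩ := SimpleGraph.Walk.exists_isPath_forall_isPath_length_le_length G
  have hnil : ¬ p.Nil := by
    intro h
    have h1 := hmax _ _ hab.toWalk (by simpa using hab.ne)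
    have h2 := SimpleGraph.Walk.length_eq_zero_iff.2 h
    simp [h2] at h1
  -- The start of a longest path is a leaf: in a forest, any further neighbour would extend the
  -- path.
  refine ⟨u, p.snd, p.adj_snd hnil, fun w hadj => ?_⟩
  apply hG.eq_snd_of_adj_start hp hadj
  by_contra hw
  have h1 := hmax _ _ (p.cons hadj.symm) (hp.cons hw)
  simp at h1

/-- Removing the edges at the neighbour of a leaf lowers the rank by two. -/
theorem rank_eq_deleteIncidenceSet_add_two {V : Type*} [Fintype V] {G : SimpleGraph V} {p q : V}
    (hpq : G.Adj p q) (hp : ∀ w, G.Adj p w → w = q) :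
    rank G = rank (G.deleteIncidenceSet q) + 2 := by
  classical
  set F := G.deleteIncidenceSet q
  have hF : ∀ x v, (adjMat F).mulVec x v =
      if v = q then 0 else (adjMat G).mulVec x v - if G.Adj v q then x q else 0 := by
    intro x v
    rw [adjMat_mulVec_apply, adjMat_mulVec_apply]
    simp only [F, SimpleGraph.deleteIncidenceSet_adj]
    split_ifs with h1 h2
    · simp [h1]
    · rw [← Finset.add_sum_erase _ _ (Finset.mem_univ q),
        ← Finset.add_sum_erase _ (fun w => if G.Adj v w then x w else 0) (Finset.mem_univ q)]
      simp only [h2, ne_eq, not_true_eq_false, and_false, if_false, if_true, zero_add,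
        add_sub_cancel_left]
      refine Finset.sum_congr rfl fun w hw => ?_
      simp [h1, Finset.ne_of_mem_erase hw]
    · rw [sub_zero]
      refine Finset.sum_congr rfl fun w _ => ?_
      by_cases h3 : w = q
      · subst h3; simp [h2]
      · simp [h1, h3]
  have hGp : ∀ x, (adjMat G).mulVec x p = x q := by
    intro x
    rw [adjMat_mulVec_apply, Finset.sum_eq_single q]
    · simp [hpq]
    · intro w _ hw
      exact if_neg fun h => hw (hp w h)
    · simp
  have hker : ∀ x, x ∈ nullSpace G ↔ x ∈ nullSpace F ∧ x q = 0 ∧ (adjMat G).mulVec x q = 0 := by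
    intro x
    rw [mem_nullSpace_iff, mem_nullSpace_iff]
    constructor
    · intro h
      have hq : x q = 0 := by rw [← hGp x, h]; rfl
      refine ⟨?_, hq, by rw [h]; rfl⟩
      ext v
      rw [hF, h, hq]
      simp
    · rintro ⟨h1, h2, h3⟩
      ext v
      have := congrFun h1 v
      rw [hF, h2] at this
      by_cases hv : v = q
      · rw [hv, h3]; rfl
      · simpa [hv] using this
  -- The two coordinates are the conditions cutting `nullSpace G` out of `nullSpace F`. They are
  -- independent because `p` and `q` are isolated in `F`, so their unit vectors are null there; the
  -- nullity thus drops by exactly two.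
  let φ : nullSpace F →ₗ[ℝ] ℝ × ℝ :=
    ((LinearMap.proj q).prod ((LinearMap.proj q).comp (adjMat G).mulVecLin)).comp
      (nullSpace F).subtype
  have hφ : ∀ x, φ x = ((x : V → ℝ) q, (adjMat G).mulVec x q) := fun x => rfl
  have hnull : ∀ v, (∀ w, ¬ F.Adj w v) → (Pi.single v 1 : V → ℝ) ∈ nullSpace F := by
    intro v hv
    rw [mem_nullSpace_iff]
    ext w
    rw [adjMat_mulVec_apply, Finset.sum_eq_zero]
    · rfl
    · intro u _
      by_cases huv : u = v
      · subst huv; simp [hv]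
      · simp [huv]
  have hq_mem := hnull q fun w h => (SimpleGraph.deleteIncidenceSet_adj.1 h).2.2 rfl
  have hp_mem := hnull p fun w h =>
    (SimpleGraph.deleteIncidenceSet_adj.1 h).2.1 (hp w (SimpleGraph.deleteIncidenceSet_adj.1 h).1.symm)
  have hsurj : LinearMap.range φ = ⊤ := by
    rw [LinearMap.range_eq_top]
    rintro ⟨s, t⟩
    refine ⟨s • ⟨_, hq_mem⟩ + t • ⟨_, hp_mem⟩, ?_⟩
    have h1 : (adjMat G).mulVec (Pi.single q 1) q = 0 := by
      rw [adjMat_mulVec_apply]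
      refine Finset.sum_eq_zero fun u _ => ?_
      by_cases huv : u = q
      · subst huv; simp
      · simp [huv]
    have h2 : (adjMat G).mulVec (Pi.single p 1) q = 1 := by
      rw [adjMat_mulVec_apply, Finset.sum_eq_single p]
      · simp [hpq.symm]
      · intro u _ hu
        simp [hu]
      · simp
    rw [map_add, map_smul, map_smul, hφ, hφ]
    simp only [h1, h2]
    simp [hpq.ne']
  have hmap : (LinearMap.ker φ).map (nullSpace F).subtype = nullSpace G := by
    ext x
    simp only [Submodule.mem_map, LinearMap.mem_ker, hφ, Prod.mk_eq_zero, Submodule.subtype_apply,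
      Subtype.exists, hker]
    constructor
    · rintro ⟨y, hy, h, rfl⟩
      exact ⟨hy, h⟩
    · rintro ⟨hy, h⟩
      exact ⟨x, hy, h, rfl⟩
  have h1 : Module.finrank ℝ (nullSpace G) + 2 = Module.finrank ℝ (nullSpace F) := by
    have := LinearMap.finrank_range_add_finrank_ker φ
    rw [hsurj, finrank_top, Module.finrank_prod, Module.finrank_self] at this
    rw [← hmap, Submodule.finrank_map_subtype_eq]
    omega
  have hrank : ∀ H : SimpleGraph V,
      rank H + Module.finrank ℝ (nullSpace H) = Module.finrank ℝ (V → ℝ) :=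
    fun H => LinearMap.finrank_range_add_finrank_ker (adjMat H).mulVecLin
  have hG := hrank G
  have hF' := hrank F
  omega

/-- In a finite forest the rank is twice the size of a maximum matching. -/
theorem rank_eq_two_mul_matching {V : Type*} [Fintype V] (G : SimpleGraph V) (hG : G.IsAcyclic) :
    (∃ M, IsMatching G M ∧ rank G ≤ 2 * M.card) ∧
      ∀ M, IsMatching G M → 2 * M.card ≤ rank G := by
  classical
  induction G using WellFoundedLT.induction with
  | ind G ih =>
  by_cases hbot : G = ⊥
  · subst hbot
    refine ⟨⟨∅, ⟨by simp, by simp⟩, ?_⟩, fun M hM => ?_⟩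
    · have : adjMat (⊥ : SimpleGraph V) = 0 := by
        ext v w
        simp [adjMat, SimpleGraph.adjMatrix_apply]
      simp [rank, this]
    · have : M = ∅ := Finset.eq_empty_of_forall_notMem fun e he => by simpa using hM.1 e he
      simp [this]
  obtain ⟨p, q, hpq, hp⟩ := exists_leaf hG hbot
  rw [rank_eq_deleteIncidenceSet_add_two hpq hp]
  have hlt : G.deleteIncidenceSet q < G := by
    refine lt_of_le_of_ne (G.deleteIncidenceSet_le q) fun h => ?_
    rw [← h] at hpq
    exact (SimpleGraph.deleteIncidenceSet_adj.1 hpq).2.2 rfl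
  obtain ⟨⟨M, hM, hMr⟩, hmax⟩ := ih _ hlt (hG.anti hlt.le)
  constructor
  · have hq : ∀ f ∈ M, q ∉ f := by
      intro f hf hqf
      have := hM.1 f hf
      rw [SimpleGraph.edgeSet_deleteIncidenceSet] at this
      exact this.2 ⟨this.1, hqf⟩
    have hpM : ∀ f ∈ M, p ∉ f := by
      intro f hf hpf
      obtain ⟨w, rfl⟩ := hpf
      have := hM.1 _ hf
      rw [SimpleGraph.mem_edgeSet, SimpleGraph.deleteIncidenceSet_adj] at this
      exact this.2.2 (hp w this.1)
    have hnot : s(p, q) ∉ M := fun h => hq _ h (by simp)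
    refine ⟨insert s(p, q) M, ⟨?_, ?_⟩, ?_⟩
    · intro f hf
      rcases Finset.mem_insert.1 hf with rfl | hf
      · exact hpq
      · exact SimpleGraph.edgeSet_mono hlt.le (hM.1 f hf)
    · intro f hf g hg hfg x hx
      rcases Finset.mem_insert.1 hf with rfl | hf' <;>
        rcases Finset.mem_insert.1 hg with rfl | hg'
      · exact hfg rfl
      · rcases Sym2.mem_iff.1 hx.1 with rfl | rfl
        · exact hpM _ hg' hx.2
        · exact hq _ hg' hx.2
      · rcases Sym2.mem_iff.1 hx.2 with rfl | rfl
        · exact hpM _ hf' hx.1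
        · exact hq _ hf' hx.1
      · exact hM.2 f hf' g hg' hfg x hx
    · rw [Finset.card_insert_of_notMem hnot]
      omega
  · intro M' hM'
    have h1 : IsMatching (G.deleteIncidenceSet q) (M'.filter fun f => q ∉ f) := by
      refine ⟨fun f hf => ?_, fun f hf g hg => ?_⟩
      · rw [Finset.mem_filter] at hf
        rw [SimpleGraph.edgeSet_deleteIncidenceSet]
        exact ⟨hM'.1 f hf.1, fun h => hf.2 h.2⟩
      · exact hM'.2 f (Finset.mem_filter.1 hf).1 g (Finset.mem_filter.1 hg).1
    have h2 := hmax _ h1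
    -- Passing to the smaller forest costs a matching at most its one edge at `q`, against a rank
    -- loss of two.
    have h3 : (M'.filter fun f => q ∈ f).card ≤ 1 := by
      rw [Finset.card_le_one]
      intro f hf g hg
      rw [Finset.mem_filter] at hf hg
      by_contra hfg
      exact hM'.2 f hf.1 g hg.1 hfg q ⟨hf.2, hg.2⟩
    have h4 := Finset.card_filter_add_card_filter_not (s := M') (fun f => q ∈ f)
    omega

/-! ### Components of induced subgraphs and connection edges -/

theorem subset_of_mem_components {V : Type*} {G : SimpleGraph V} {W P : Set V}
    (hP : P ∈ components G W) : P ⊆ W := by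
  obtain ⟨C, rfl⟩ := hP
  rintro _ ⟨x, -, rfl⟩
  exact x.2

theorem exists_component {V : Type*} (G : SimpleGraph V) {W : Set V} {x : V} (hx : x ∈ W) :
    ∃ P ∈ components G W, x ∈ P :=
  ⟨_, ⟨(G.induce W).connectedComponentMk ⟨x, hx⟩, rfl⟩, ⟨x, hx⟩, rfl, rfl⟩

theorem sUnion_components {V : Type*} (G : SimpleGraph V) (W : Set V) :
    ⋃₀ components G W = W := by
  ext x
  refine ⟨fun ⟨P, hP, hx⟩ => subset_of_mem_components hP hx, fun hx => ?_⟩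
  obtain ⟨P, hP, hxP⟩ := exists_component G hx
  exact ⟨P, hP, hxP⟩

theorem reachable_of_mem_component {V : Type*} {G : SimpleGraph V} {W P : Set V}
    (hP : P ∈ components G W) {x y : V} (hx : x ∈ P) (hy : y ∈ P) :
    (G.induce W).Reachable ⟨x, subset_of_mem_components hP hx⟩
      ⟨y, subset_of_mem_components hP hy⟩ := by
  obtain ⟨C, rfl⟩ := hP
  obtain ⟨x, hx, rfl⟩ := hx
  obtain ⟨y, hy, rfl⟩ := hy
  exact SimpleGraph.ConnectedComponent.exact (hx.trans hy.symm)

theorem mem_component_of_reachable {V : Type*} {G : SimpleGraph V} {W P : Set V}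
    (hP : P ∈ components G W) {x y : W} (h : (G.induce W).Reachable x y) (hx : (x : V) ∈ P) :
    (y : V) ∈ P := by
  obtain ⟨C, rfl⟩ := hP
  obtain ⟨x', hx', h'⟩ := hx
  obtain rfl := Subtype.ext h'
  exact ⟨y, (SimpleGraph.ConnectedComponent.sound h.symm).trans hx', rfl⟩

theorem component_unique {V : Type*} {G : SimpleGraph V} {W P Q : Set V}
    (hP : P ∈ components G W) (hQ : Q ∈ components G W) {x : V} (hxP : x ∈ P) (hxQ : x ∈ Q) :
    P = Q := by
  ext y
  exact ⟨fun hy => mem_component_of_reachable hQ (reachable_of_mem_component hP hxP hy) hxQ,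
    fun hy => mem_component_of_reachable hP (reachable_of_mem_component hQ hxQ hy) hxP⟩

theorem mem_component_of_adj {V : Type*} {G : SimpleGraph V} {W P : Set V}
    (hP : P ∈ components G W) {x y : V} (hx : x ∈ P) (hy : y ∈ W) (h : G.Adj x y) : y ∈ P :=
  mem_component_of_reachable hP (x := ⟨x, subset_of_mem_components hP hx⟩) (y := ⟨y, hy⟩)
    (SimpleGraph.Adj.reachable (by simpa using h)) hx

/-- A component survives the removal of an edge that leaves the inducing set. -/
theorem reachable_deleteEdges_of_mem_component {V : Type*} {G : SimpleGraph V} {W P : Set V}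
    (hP : P ∈ components G W) {e : Sym2 V} (he : ∃ z ∈ e, z ∉ W) {x y : V} (hx : x ∈ P)
    (hy : y ∈ P) : (G.deleteEdges {e}).Reachable x y := by
  let φ : G.induce W →g G.deleteEdges {e} :=
    { toFun := Subtype.val
      map_rel' := by
        rintro ⟨s, hs⟩ ⟨t, ht⟩ hst
        rw [SimpleGraph.deleteEdges_adj]
        refine ⟨hst, ?_⟩
        rintro rfl
        obtain ⟨z, hz, hzW⟩ := he
        rcases Sym2.mem_iff.1 hz with rfl | rfl
        · exact hzW hs
        · exact hzW ht }
  exact (reachable_of_mem_component hP hx hy).map φ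

/-- An edge with both ends in a set lies inside one component of that set; apply this to the closed
neighbourhood of the support and to its complement. -/
theorem exists_mem_and_notMem_of_mem_connEdges {V : Type*} [Fintype V] {T : SimpleGraph V}
    {e : Sym2 V} (he : e ∈ connEdges T) :
    ∃ a b, e = s(a, b) ∧ T.Adj a b ∧ a ∈ closedNbhd T (supp T) ∧ b ∉ closedNbhd T (supp T) := by
  induction e with
  | h a b =>
  obtain ⟨hadj, hnot⟩ := he
  have hin : ∀ W, a ∈ W → b ∈ W → s(a, b) ∈ partEdges T (components T W) := by
    intro W ha hb
    obtain ⟨P, hP, haP⟩ := exists_component T ha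
    refine ⟨hadj, P, hP, fun x hx => ?_⟩
    rcases Sym2.mem_iff.1 hx with rfl | rfl
    · exact haP
    · exact mem_component_of_adj hP haP hb hadj
  by_cases ha : a ∈ closedNbhd T (supp T) <;> by_cases hb : b ∈ closedNbhd T (supp T)
  · exact absurd (Or.inl (hin _ ha hb)) hnot
  · exact ⟨a, b, rfl, hadj, ha, hb⟩
  · exact ⟨b, a, Sym2.eq_swap, hadj.symm, hb, ha⟩
  · refine absurd (Or.inr (hin _ ?_ ?_)) hnot <;> simpa only [sParts, sUnion_components]

theorem mem_nbhd_iff {V : Type*} {G : SimpleGraph V} {W : Set V} {v : V} :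
    v ∈ nbhd G W ↔ ∃ w ∈ W, G.Adj w v := by
  simp [nbhd]

/-! ### Core vertices and the edge exchange -/

/-- The core of an S-part of a forest avoids the support of the forest. -/
theorem mem_and_not_mem_supp_of_mem_partCore {V : Type*} [Fintype V] {T : SimpleGraph V}
    (hT : T.IsAcyclic) {S : Set V} (hS : S ∈ sParts T) {u : V} (hu : u ∈ partCore T S) :
    u ∈ S ∧ u ∉ supp T := by
  classical
  obtain ⟨u, hu, rfl⟩ := hu
  refine ⟨u.2, ?_⟩
  obtain ⟨w, hw, hwu⟩ := mem_nbhd_iff.1 hu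
  rintro ⟨x, hx, hxu⟩
  -- A null vector of `T` restricts to one of the induced subgraph: a neighbour of `S` with non-zero
  -- value is in the support of `T`, hence already in `S`. Independence of the support within `S`
  -- then gives the contradiction.
  refine not_mem_supp_of_adj (hT.induce S) hwu hw ⟨fun s => x s, ?_, hxu⟩
  rw [mem_nullSpace_iff] at hx ⊢
  ext s
  have h := congrFun hx s
  rw [adjMat_mulVec_apply] at h ⊢
  refine Eq.trans ?_ h
  refine Finset.sum_of_injOn Subtype.val Subtype.val_injective.injOn (by simp) ?_ fun t _ => ?_
  · intro t _ ht
    split_ifs with hst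
    · by_contra hxt
      exact ht ⟨⟨t, mem_component_of_adj hS s.2 (Or.inl ⟨x, (mem_nullSpace_iff _ _).2 hx, hxt⟩) hst⟩,
        by simp⟩
    · rfl
  · rfl

/-- The new edge crosses the same cut as the old one: it joins distinct components of `G`, and `a`
still reaches `b` through it. -/
theorem isTree_sup_edge {V : Type*} {G : SimpleGraph V} {a b u v : V}
    (hT : (G ⊔ SimpleGraph.edge a b).IsTree) (hab : ¬ G.Reachable a b)
    (hua : G.Reachable u a) (hvb : G.Reachable v b) :
    (G ⊔ SimpleGraph.edge u v).IsTree := by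
  have huv : ¬ G.Reachable u v := fun h => hab (hua.symm.trans (h.trans hvb))
  have hne : u ≠ v := by rintro rfl; exact huv (SimpleGraph.Reachable.refl _)
  have hG : G.IsAcyclic := hT.isAcyclic.anti le_sup_left
  have hle : G ≤ G ⊔ SimpleGraph.edge u v := le_sup_left
  have hadj : (G ⊔ SimpleGraph.edge u v).Adj u v := by
    simp [SimpleGraph.sup_adj, SimpleGraph.edge_adj, hne]
  have hreach : (G ⊔ SimpleGraph.edge u v).Reachable a b :=
    (hua.symm.mono hle).trans (hadj.reachable.trans (hvb.mono hle))
  have hstep : ∀ x y, (G ⊔ SimpleGraph.edge a b).Adj x y →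
      (G ⊔ SimpleGraph.edge u v).Reachable x y := by
    intro x y hxy
    rw [SimpleGraph.sup_adj, SimpleGraph.edge_adj] at hxy
    rcases hxy with h | ⟨⟨rfl, rfl⟩ | ⟨rfl, rfl⟩, -⟩
    · exact (hle h).reachable
    · exact hreach
    · exact hreach.symm
  have : Nonempty V := ⟨a⟩
  refine ⟨⟨fun x y => ?_⟩, hG.sup_edge_of_not_reachable huv⟩
  obtain ⟨p⟩ := hT.connected.preconnected x y
  induction p with
  | nil => exact SimpleGraph.Reachable.refl _
  | cons h _ ih => exact (hstep _ _ h).trans ih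

theorem notMem_closedNbhd {V : Type*} [Fintype V] {T : SimpleGraph V} {N : Set V}
    (hN : N ∈ nParts T) {x : V} (hx : x ∈ N) : x ∉ closedNbhd T (supp T) := by
  have := subset_of_mem_components hN hx
  rwa [sParts, sUnion_components] at this

/-- Removing a connection edge does not change the null space. -/
theorem nullSpace_deleteEdges_connection {V : Type*} [Fintype V] {T : SimpleGraph V}
    (hT : T.IsAcyclic) {a b : V} (h : T.Adj a b) (ha : a ∈ closedNbhd T (supp T))
    (hb : b ∉ closedNbhd T (supp T)) :
    nullSpace (T.deleteEdges {s(a, b)}) = nullSpace T := by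
  have hbs : b ∉ supp T := fun hs => hb (Or.inl hs)
  have has : a ∉ supp T := fun hs => hb (Or.inr (mem_nbhd_iff.2 ⟨a, hs, h⟩))
  obtain ⟨w, hw, hwa⟩ := mem_nbhd_iff.1 (ha.resolve_left has)
  have hTG := deleteEdges_sup_edge_eq h
  have hnr := not_reachable_deleteEdges hT h
  set G := T.deleteEdges {s(a, b)} with hGdef
  have hG : G.IsAcyclic := hT.anti (SimpleGraph.deleteEdges_le _)
  have hadj : ¬ G.Adj a b := fun h => hnr h.reachable
  -- Null vectors of `T` vanish at `a` and `b`, so they remain null without the edge.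
  have hwG : w ∈ supp G := by
    classical
    obtain ⟨y, hy, hyw⟩ := hw
    refine ⟨y, ?_, hyw⟩
    have hya := not_mem_supp_iff.1 has y hy
    have hyb := not_mem_supp_iff.1 hbs y hy
    rw [mem_nullSpace_iff, ← hTG, adjMat_mulVec_sup_edge h.ne hadj, hya, hyb] at hy
    rw [mem_nullSpace_iff]
    simpa using hy
  have hwaG : G.Adj w a := by
    rw [hGdef, SimpleGraph.deleteEdges_adj]
    refine ⟨hwa, fun hs => ?_⟩
    rw [Set.mem_singleton_iff, Sym2.eq_iff] at hs
    rcases hs with ⟨h1, -⟩ | ⟨h1, -⟩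
    · exact has (h1 ▸ hw)
    · exact hbs (h1 ▸ hw)
  have haG : a ∉ supp G := not_mem_supp_of_adj hG hwaG hwG
  have hbG : b ∉ supp G :=
    not_mem_supp_of_sup_edge hG hnr haG (hTG.symm ▸ has) (hTG.symm ▸ hbs)
  rw [← nullSpace_sup_edge hG hnr haG hbG, hTG]

theorem rank_eq_of_nullSpace_eq {V : Type*} [Fintype V] {G H : SimpleGraph V}
    (h : nullSpace G = nullSpace H) : rank G = rank H := by
  have hrank : ∀ K : SimpleGraph V,
      rank K + Module.finrank ℝ (nullSpace K) = Module.finrank ℝ (V → ℝ) :=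
    fun K => LinearMap.finrank_range_add_finrank_ker (adjMat K).mulVecLin
  have h1 := hrank G
  have h2 := hrank H
  rw [h] at h1
  omega

end NullDecomp

/-! ### The main theorem -/

open NullDecomp in
theorem mainTheorem11 {V : Type*} [Fintype V] (T : SimpleGraph V) (hT : T.IsTree)
    (e : Sym2 V) (he : e ∈ NullDecomp.connEdges T) :
    (∃! S : Set V, S ∈ NullDecomp.sParts T ∧ NullDecomp.Meets e S) ∧
    (∃! N : Set V, N ∈ NullDecomp.nParts T ∧ NullDecomp.Meets e N) ∧
    ∀ S ∈ NullDecomp.sParts T, NullDecomp.Meets e S →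
    ∀ N ∈ NullDecomp.nParts T, NullDecomp.Meets e N →
    ∀ u ∈ NullDecomp.partCore T S, ∀ v ∈ N,
      (NullDecomp.replaceEdge T e u v).IsTree ∧
      (∀ M ∈ NullDecomp.maxMatchings T, Disjoint (M : Set (Sym2 V)) (NullDecomp.connEdges T) →
        M ∈ NullDecomp.maxMatchings (NullDecomp.replaceEdge T e u v)) ∧
      NullDecomp.nullSpace T = NullDecomp.nullSpace (NullDecomp.replaceEdge T e u v) ∧
      NullDecomp.nullity T = NullDecomp.nullity (NullDecomp.replaceEdge T e u v) ∧
      NullDecomp.rank T = NullDecomp.rank (NullDecomp.replaceEdge T e u v) := by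
  obtain ⟨a, b, rfl, hab, ha, hb⟩ := exists_mem_and_notMem_of_mem_connEdges he
  have hbc : b ∈ (⋃₀ sParts T)ᶜ := by rwa [sParts, sUnion_components]
  have hSa : ∀ S ∈ sParts T, Meets s(a, b) S → a ∈ S := by
    rintro S hS ⟨x, hx, hxS⟩
    rcases Sym2.mem_iff.1 hx with rfl | rfl
    · exact hxS
    · exact absurd (subset_of_mem_components hS hxS) hb
  have hNb : ∀ N ∈ nParts T, Meets s(a, b) N → b ∈ N := by
    rintro N hN ⟨x, hx, hxN⟩
    rcases Sym2.mem_iff.1 hx with rfl | rfl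
    · exact absurd ha (notMem_closedNbhd hN hxN)
    · exact hxN
  refine ⟨?_, ?_, ?_⟩
  · obtain ⟨S, hS, haS⟩ := exists_component T ha
    exact ⟨S, ⟨hS, a, Sym2.mem_mk_left a b, haS⟩,
      fun S' h => component_unique h.1 hS (hSa S' h.1 h.2) haS⟩
  · obtain ⟨N, hN, hbN⟩ := exists_component T hbc
    exact ⟨N, ⟨hN, b, Sym2.mem_mk_right a b, hbN⟩,
      fun N' h => component_unique h.1 hN (hNb N' h.1 h.2) hbN⟩
  intro S hS hSe N hN hNe u hu v hv
  obtain ⟨huS, hus⟩ := mem_and_not_mem_supp_of_mem_partCore hT.isAcyclic hS hu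
  have hvs : v ∉ supp T := fun h => notMem_closedNbhd hN hv (Or.inl h)
  have hua := reachable_deleteEdges_of_mem_component hS ⟨b, Sym2.mem_mk_right a b, hb⟩ huS
    (hSa S hS hSe)
  have hvb := reachable_deleteEdges_of_mem_component hN
    ⟨a, Sym2.mem_mk_left a b, by rwa [sParts, sUnion_components, Set.notMem_compl_iff]⟩ hv
    (hNb N hN hNe)
  have hnr := not_reachable_deleteEdges hT.isAcyclic hab
  have hnull := nullSpace_deleteEdges_connection hT.isAcyclic hab ha hb
  have hG : (T.deleteEdges {s(a, b)}).IsAcyclic :=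
    hT.isAcyclic.anti (SimpleGraph.deleteEdges_le _)
  have hsupp : supp (T.deleteEdges {s(a, b)}) = supp T := by simp only [supp, hnull]
  have htree : (replaceEdge T s(a, b) u v).IsTree :=
    isTree_sup_edge ((deleteEdges_sup_edge_eq hab).symm ▸ hT) hnr hua hvb
  have heq : nullSpace T = nullSpace (replaceEdge T s(a, b) u v) :=
    (hnull.symm.trans (nullSpace_sup_edge hG
      (fun h => hnr (hua.symm.trans (h.trans hvb))) (hsupp ▸ hus) (hsupp ▸ hvs)).symm)
  refine ⟨htree, fun M hM hdisj => ⟨⟨fun f hf => ?_, hM.1.2⟩, fun M' hM' => ?_⟩, heq, ?_,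
    rank_eq_of_nullSpace_eq heq⟩
  · have hfe : f ≠ s(a, b) := by
      rintro rfl
      exact Set.disjoint_left.1 hdisj (Finset.mem_coe.2 hf) he
    refine SimpleGraph.edgeSet_mono (le_sup_left : T.deleteEdges {s(a, b)} ≤ _) ?_
    rw [SimpleGraph.edgeSet_deleteEdges]
    exact ⟨hM.1.1 f hf, hfe⟩
  -- With T' the new tree: 2|M'| ≤ rank T' = rank T ≤ 2|M₀| ≤ 2|M|.
  · obtain ⟨M₀, hM₀, hcard⟩ := (rank_eq_two_mul_matching T hT.isAcyclic).1
    have h1 := hM.2 M₀ hM₀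
    have h2 := (rank_eq_two_mul_matching _ htree.isAcyclic).2 M' hM'
    have h3 := rank_eq_of_nullSpace_eq heq
    omega
  · rw [nullity, nullity, heq]
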